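/- Let $\mathsf{HA}$ be Heyting arithmetic: first-order intuitionistic arithmetic with primitive logical constants $\bot,\land,\lor,\to,\forall,\exists$, with function symbols for all primitive recursive functions and their defining equations, and with equality, the successor axioms and full induction. Let $\mathsf{PA}=\mathsf{HA}+\mathrm{LEM}$, where $\mathrm{LEM}$ is the schema $\varphi\lor\neg\varphi$ for all formulas $\varphi$. Let $\Sigma_0=\Pi_0$ be the class of quantifier-free formulas, let $\Sigma_{k+1}$ be the class of formulas $\exists \overline{x}\,\varphi$ with $\varphi\in\Pi_k$, and let $\Pi_{k+1}$ be the class of formulas $\forall\overline{x}\,\varphi$ with $\varphi\in\Sigma_k$, where $\overline{x}$ is a finite, possibly empty, list of variables. A formula is in prenex normal form if it belongs to $\Sigma_k\cup\Pi_k$ for some $k$. Let $\Sigma_k\text{-}\mathrm{LEM}$ be the schema $\forall x\,(\varphi(x)\lor\neg\varphi(x))$, where $\varphi(x)\in\Sigma_k$ has no free variable other than $x$. Theorem. Let $k$ be a natural number. For any formula $\varphi\in\Pi_{k+2}$ and any formula $\psi$ in prenex normal form (both possibly with free variables), if $\mathsf{PA}\vdash\psi\to\varphi$, then $\mathsf{HA}+\Sigma_k\text{-}\mathrm{LEM}\vdash\psi\to\varphi$.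 -/

import Mathlib

namespace Arith

/-! ## Language and terms -/

/-- Function symbols for all primitive recursive functions: one symbol of arity `n` for every
primitive recursive definition of an `n`-ary function. -/
inductive PRSymb : ℕ → Type
  | zero : PRSymb 0
  | succ : PRSymb 1
  | proj {n : ℕ} (i : Fin n) : PRSymb n
  | comp {m n : ℕ} (f : PRSymb m) (g : Fin m → PRSymb n) : PRSymb n
  | prec {n : ℕ} (f : PRSymb n) (g : PRSymb (n + 2)) : PRSymb (n + 1)

/-- The language of arithmetic: all primitive recursive function symbols; equality is the only
predicate and is built into the formulas below. -/
def lang : FirstOrder.Language.{0, 0} where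
  Functions := PRSymb
  Relations := fun _ => Empty

/-- Terms, with de Bruijn variables `0, 1, 2, …`. -/
abbrev Tm : Type := lang.Term ℕ

/-- Application of a primitive recursive function symbol. -/
def app {n : ℕ} (f : PRSymb n) (ts : Fin n → Tm) : Tm := FirstOrder.Language.Term.func (L := lang) f ts

/-- The variable with de Bruijn index `n`. -/
def bvar (n : ℕ) : Tm := FirstOrder.Language.Term.var n

/-- The constant `0`. -/
def zeroTm : Tm := app PRSymb.zero ![]

/-- The term `S t`. -/
def succTm (t : Tm) : Tm := app PRSymb.succ ![t]

/-- Passing under a quantifier: variable `0` is kept and all other values are shifted. -/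
def up (σ : ℕ → Tm) : ℕ → Tm
  | 0 => bvar 0
  | n + 1 => (σ n).relabel Nat.succ

/-! ## Formulas

Mathlib's first-order formulas have only `⊥`, `→`, `∀` as primitives and define `∧`, `∨`, `∃`
classically, so intuitionistic logic needs its own formulas. -/

/-- Formulas of arithmetic, all of `⊥, ∧, ∨, →, ∀, ∃` being primitive. In `all φ` and `ex φ` the
bound variable is the variable `0` of `φ`, and the variable `n + 1` of `φ` is the variable `n` of
the quantified formula. -/
inductive Formula : Type
  | bot : Formula
  | eq (t s : Tm) : Formula
  | and (φ ψ : Formula) : Formula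
  | or (φ ψ : Formula) : Formula
  | imp (φ ψ : Formula) : Formula
  | all (φ : Formula) : Formula
  | ex (φ : Formula) : Formula

namespace Formula

/-- Negation `φ → ⊥`. -/
def neg (φ : Formula) : Formula := imp φ bot

/-- Simultaneous capture-avoiding substitution of terms for the free variables. -/
def subst : Formula → (ℕ → Tm) → Formula
  | bot, _ => bot
  | eq t s, σ => eq (t.subst σ) (s.subst σ)
  | and φ ψ, σ => and (φ.subst σ) (ψ.subst σ)
  | or φ ψ, σ => or (φ.subst σ) (ψ.subst σ)
  | imp φ ψ, σ => imp (φ.subst σ) (ψ.subst σ)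
  | all φ, σ => all (φ.subst (up σ))
  | ex φ, σ => ex (φ.subst (up σ))

/-- The substitution that sends variable `0` to `t` and lowers all other variables by one. -/
def instSubst (t : Tm) : ℕ → Tm
  | 0 => t
  | n + 1 => bvar n

/-- `φ(t)`: the term `t` replaces the variable `0` that a quantifier in front of `φ` would bind. -/
def inst (φ : Formula) (t : Tm) : Formula := φ.subst (instSubst t)

/-- `φ` with all free variables shifted by one, so that the variable `0` is fresh. -/
def lift (φ : Formula) : Formula := φ.subst fun n => bvar (n + 1)

/-- `φ(S x)`, where `x` is the variable `0` of `φ`. -/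
def succInst (φ : Formula) : Formula :=
  φ.subst fun n => match n with
    | 0 => succTm (bvar 0)
    | n + 1 => bvar (n + 1)

/-- The set of free variables. -/
def fv : Formula → Set ℕ
  | bot => ∅
  | eq t s => ↑t.varFinset ∪ ↑s.varFinset
  | and φ ψ => φ.fv ∪ ψ.fv
  | or φ ψ => φ.fv ∪ ψ.fv
  | imp φ ψ => φ.fv ∪ ψ.fv
  | all φ => {n | n + 1 ∈ φ.fv}
  | ex φ => {n | n + 1 ∈ φ.fv}

/-- Quantifier-free formulas. -/
def QF : Formula → Prop
  | bot => True
  | eq _ _ => True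
  | and φ ψ => φ.QF ∧ ψ.QF
  | or φ ψ => φ.QF ∧ ψ.QF
  | imp φ ψ => φ.QF ∧ ψ.QF
  | all _ => False
  | ex _ => False

end Formula

/-! ## The classes `Σ_k` and `Π_k`

A block of `n` like quantifiers is `ex^[n]` or `all^[n]`. Blocks may be empty, so the classes are
cumulative. -/

mutual
/-- `Σ_0` is the class of quantifier-free formulas, and `Σ_{k+1}` that of all `∃ x₁ … xₙ φ` with
`φ` in `Π_k`. -/
def SigmaClass : ℕ → Set Formula
  | 0 => {φ | φ.QF}
  | k + 1 => {χ | ∃ (n : ℕ) (φ : Formula), φ ∈ PiClass k ∧ χ = Formula.ex^[n] φ}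
/-- `Π_0` is the class of quantifier-free formulas, and `Π_{k+1}` that of all `∀ x₁ … xₙ φ` with
`φ` in `Σ_k`. -/
def PiClass : ℕ → Set Formula
  | 0 => {φ | φ.QF}
  | k + 1 => {χ | ∃ (n : ℕ) (φ : Formula), φ ∈ SigmaClass k ∧ χ = Formula.all^[n] φ}
end

/-- Formulas of prenex normal form. -/
def IsPrenex (φ : Formula) : Prop := ∃ k : ℕ, φ ∈ SigmaClass k ∪ PiClass k

/-! ## Derivability -/

/-- `Prf T Γ φ`: in intuitionistic natural deduction `φ` is derivable from the open assumptions
`Γ` and the non-logical axioms `T`. Free variables of an axiom are read universally, those of an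
assumption are fixed (hence the shift of `Γ`, and not of `T`, in the quantifier rules). -/
inductive Prf (T : Set Formula) : List Formula → Formula → Prop
  | ax {Γ φ} : φ ∈ T → Prf T Γ φ
  | hyp {Γ φ} : φ ∈ Γ → Prf T Γ φ
  | botE {Γ φ} : Prf T Γ Formula.bot → Prf T Γ φ
  | andI {Γ φ ψ} : Prf T Γ φ → Prf T Γ ψ → Prf T Γ (φ.and ψ)
  | andE₁ {Γ φ ψ} : Prf T Γ (Formula.and φ ψ) → Prf T Γ φ
  | andE₂ {Γ φ ψ} : Prf T Γ (Formula.and φ ψ) → Prf T Γ ψ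
  | orI₁ {Γ φ ψ} : Prf T Γ φ → Prf T Γ (φ.or ψ)
  | orI₂ {Γ φ ψ} : Prf T Γ ψ → Prf T Γ (Formula.or φ ψ)
  | orE {Γ φ ψ χ} : Prf T Γ (Formula.or φ ψ) → Prf T (φ :: Γ) χ → Prf T (ψ :: Γ) χ → Prf T Γ χ
  | impI {Γ φ ψ} : Prf T (φ :: Γ) ψ → Prf T Γ (φ.imp ψ)
  | impE {Γ φ ψ} : Prf T Γ (Formula.imp φ ψ) → Prf T Γ φ → Prf T Γ ψ
  | allI {Γ φ} : Prf T (Γ.map Formula.lift) φ → Prf T Γ φ.all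
  | allE {Γ φ} (t : Tm) : Prf T Γ (Formula.all φ) → Prf T Γ (φ.inst t)
  | exI {Γ φ} (t : Tm) : Prf T Γ (Formula.inst φ t) → Prf T Γ φ.ex
  | exE {Γ φ χ} :
      Prf T Γ (Formula.ex φ) → Prf T (φ :: Γ.map Formula.lift) χ.lift → Prf T Γ χ

/-- `T ⊢ φ`. -/
def Provable (T : Set Formula) (φ : Formula) : Prop := Prf T [] φ

/-! ## Theories -/

/-- The non-logical axioms of Heyting arithmetic: equality, `S x ≠ 0`, injectivity of `S`, the
defining equations of all primitive recursive function symbols, and induction for all formulas. -/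
inductive HAAxiom : Formula → Prop
  | eqRefl (t : Tm) : HAAxiom (.eq t t)
  | eqSubst (t s : Tm) (φ : Formula) : HAAxiom (.imp (.eq t s) (.imp (φ.inst t) (φ.inst s)))
  | succNeZero (t : Tm) : HAAxiom (Formula.neg (.eq (succTm t) zeroTm))
  | succInj (t s : Tm) : HAAxiom (.imp (.eq (succTm t) (succTm s)) (.eq t s))
  | projEq {n : ℕ} (i : Fin n) (ts : Fin n → Tm) : HAAxiom (.eq (app (.proj i) ts) (ts i))
  | compEq {m n : ℕ} (f : PRSymb m) (g : Fin m → PRSymb n) (ts : Fin n → Tm) :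
      HAAxiom (.eq (app (.comp f g) ts) (app f fun i => app (g i) ts))
  | precZero {n : ℕ} (f : PRSymb n) (g : PRSymb (n + 2)) (ts : Fin n → Tm) :
      HAAxiom (.eq (app (.prec f g) (Matrix.vecCons zeroTm ts)) (app f ts))
  | precSucc {n : ℕ} (f : PRSymb n) (g : PRSymb (n + 2)) (t : Tm) (ts : Fin n → Tm) :
      HAAxiom (.eq (app (.prec f g) (Matrix.vecCons (succTm t) ts))
        (app g (Matrix.vecCons t
          (Matrix.vecCons (app (.prec f g) (Matrix.vecCons t ts)) ts))))
  | induction (φ : Formula) :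
      HAAxiom (.imp (φ.inst zeroTm) (.imp (.all (.imp φ φ.succInst)) (.all φ)))

/-- Heyting arithmetic. -/
def HA : Set Formula := {φ | HAAxiom φ}

/-- The schema of excluded middle for all formulas. -/
def LEM : Set Formula := {χ | ∃ φ : Formula, χ = φ.or φ.neg}

/-- Peano arithmetic, `HA + LEM`. -/
def PA : Set Formula := HA ∪ LEM

/-- `C-LEM`: all sentences `∀ x (φ(x) ∨ ¬ φ(x))` with `φ(x)` in the class `C` and without free
variables other than `x`. -/
def ClassLEM (C : Set Formula) : Set Formula :=
  {χ | ∃ φ : Formula, φ ∈ C ∧ φ.fv ⊆ {0} ∧ χ = .all (φ.or φ.neg)}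

end Arith

/-!
The proof is a Friedman-style negative translation. For a formula `ρ` let `φ.trans ρ` be the
Gödel–Gentzen translation of `φ` in which `ρ` takes the place of falsity. Translated formulas are
stable under the double negation `(· → ρ) → ρ`, so a derivation in `PA` becomes one in `HA`
(`Prf.trans`), for every `ρ`.

A prenex formula `ψ` implies its translation in `HA`, because quantifier-free formulas are decidable
there; for the same reason the dual `ψ.dual` of `ψ` together with the translation of `ψ` yields `ρ`
(`Prf.prenex_trans`). With `Σ_k-LEM` every formula `χ` in `Π_k` holds or its dual does
(`Prf.or_dual`), so the translation of `χ` yields `χ` or `ρ`. Hence, for `φ = ∃ y χ` in `Σ_{k+1}` and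
`ρ = φ`, the translation of `φ` yields `φ` (`Prf.of_trans_SigmaClass_succ`), and
`ψ → ψ.trans φ → φ.trans φ → φ`. The outer universal quantifiers of a formula in `Π_{k+2}` are
stripped one at a time, the bound variable becoming a free variable that `ψ` does not contain.

The schema `Σ_k-LEM` speaks of formulas with a single free variable. Excluded middle for arbitrary
formulas in `Σ_k` follows by merging two variables into one, repeatedly, along a pairing function
that `HA` proves injective (`Prf.or_neg_of_mem_SigmaClass`). Quantifier-free formulas need no such
coding, and for `k ≥ 1` the decoding quantifiers `∃ x y` are absorbed by the leading block, so the
pairing function needs no projections.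
-/

namespace Arith
open FirstOrder.Language

/-! ### Substitution -/

theorem Term.subst_subst (t : Tm) (σ τ : ℕ → Tm) :
    Term.subst (Term.subst t σ) τ = Term.subst t (fun n => Term.subst (σ n) τ) := by
  induction t with
  | var => rfl
  | func f ts ih => simp only [Term.subst, ih]

theorem Term.subst_bvar (t : Tm) : Term.subst t bvar = t := by
  induction t with
  | var => rfl
  | func f ts ih => simp only [Term.subst, ih]

theorem Term.relabel_eq_subst (t : Tm) (f : ℕ → ℕ) :
    Term.relabel f t = Term.subst t (fun n => bvar (f n)) := by
  induction t with
  | var => rfl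
  | func f ts ih => simp only [Term.subst, Term.relabel, ih]

theorem Term.subst_congr (t : Tm) {σ τ : ℕ → Tm} (h : ∀ n ∈ t.varFinset, σ n = τ n) :
    Term.subst t σ = Term.subst t τ := by
  induction t with
  | var n => exact h n (by simp [Term.varFinset])
  | func f ts ih =>
    simp only [Term.subst]
    congr 1
    funext i
    exact ih i fun n hn => h n (by
      simp only [Term.varFinset, Finset.mem_biUnion, Finset.mem_univ, true_and]
      exact ⟨i, hn⟩)

@[simp] theorem subst_app {n : ℕ} (f : PRSymb n) (ts : Fin n → Tm) (σ : ℕ → Tm) :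
    Term.subst (app f ts) σ = app f (fun i => Term.subst (ts i) σ) := rfl

@[simp] theorem subst_bvar (n : ℕ) (σ : ℕ → Tm) : Term.subst (bvar n) σ = σ n := rfl

theorem subst_vecCons {n : ℕ} (t : Tm) (ts : Fin n → Tm) (σ : ℕ → Tm) :
    (fun i => Term.subst (Matrix.vecCons t ts i) σ) =
      Matrix.vecCons (Term.subst t σ) (fun i => Term.subst (ts i) σ) := by
  funext i
  refine Fin.cases ?_ (fun j => ?_) i <;> rfl

theorem subst_vecEmpty (σ : ℕ → Tm) :
    (fun i => Term.subst ((![] : Fin 0 → Tm) i) σ) = ![] := by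
  funext i
  exact i.elim0

@[simp] theorem subst_zeroTm (σ : ℕ → Tm) : Term.subst zeroTm σ = zeroTm := by
  simp only [zeroTm, subst_app, subst_vecEmpty]

@[simp] theorem subst_succTm (t : Tm) (σ : ℕ → Tm) :
    Term.subst (succTm t) σ = succTm (Term.subst t σ) := by
  simp only [succTm, subst_app, subst_vecCons, subst_vecEmpty]

@[simp] theorem up_zero (σ : ℕ → Tm) : up σ 0 = bvar 0 := rfl

@[simp] theorem up_succ (σ : ℕ → Tm) (n : ℕ) :
    up σ (n + 1) = Term.subst (σ n) (fun m => bvar (m + 1)) :=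
  Term.relabel_eq_subst _ _

@[simp] theorem instSubst_zero (t : Tm) : Formula.instSubst t 0 = t := rfl

@[simp] theorem instSubst_succ (t : Tm) (n : ℕ) : Formula.instSubst t (n + 1) = bvar n := rfl

theorem up_bvar : up bvar = bvar := by
  funext n
  cases n <;> simp

theorem up_comp (σ τ : ℕ → Tm) :
    (fun n => Term.subst (up σ n) (up τ)) = up (fun n => Term.subst (σ n) τ) := by
  funext n
  cases n <;> simp [Term.subst_subst]

namespace Formula

theorem subst_subst (φ : Formula) (σ τ : ℕ → Tm) :
    (φ.subst σ).subst τ = φ.subst (fun n => Term.subst (σ n) τ) := by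
  induction φ generalizing σ τ with
  | bot => rfl
  | eq t s => simp only [subst, Term.subst_subst]
  | and _ _ h₁ h₂ => simp only [subst, h₁, h₂]
  | or _ _ h₁ h₂ => simp only [subst, h₁, h₂]
  | imp _ _ h₁ h₂ => simp only [subst, h₁, h₂]
  | all _ h => simp only [subst, h, up_comp]
  | ex _ h => simp only [subst, h, up_comp]

theorem subst_id (φ : Formula) : φ.subst bvar = φ := by
  induction φ with
  | bot => rfl
  | eq t s => simp only [subst, Term.subst_bvar]
  | and _ _ h₁ h₂ => simp only [subst, h₁, h₂]
  | or _ _ h₁ h₂ => simp only [subst, h₁, h₂]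
  | imp _ _ h₁ h₂ => simp only [subst, h₁, h₂]
  | all _ h => simp only [subst, h, up_bvar]
  | ex _ h => simp only [subst, h, up_bvar]

theorem subst_congr (φ : Formula) {σ τ : ℕ → Tm} (h : ∀ n ∈ φ.fv, σ n = τ n) :
    φ.subst σ = φ.subst τ := by
  have hup : ∀ {s : Set ℕ} {σ τ : ℕ → Tm}, (∀ n ∈ {n | n + 1 ∈ s}, σ n = τ n) →
      ∀ n ∈ s, up σ n = up τ n := by
    intro s σ τ h n hn
    cases n with
    | zero => rfl
    | succ n => simp only [up_succ, h n hn]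
  induction φ generalizing σ τ with
  | bot => rfl
  | eq t s =>
    simp only [subst]
    rw [Term.subst_congr t fun n hn => h n (Or.inl hn),
      Term.subst_congr s fun n hn => h n (Or.inr hn)]
  | and _ _ h₁ h₂ =>
    simp only [subst]
    rw [h₁ fun n hn => h n (Or.inl hn), h₂ fun n hn => h n (Or.inr hn)]
  | or _ _ h₁ h₂ =>
    simp only [subst]
    rw [h₁ fun n hn => h n (Or.inl hn), h₂ fun n hn => h n (Or.inr hn)]
  | imp _ _ h₁ h₂ =>
    simp only [subst]
    rw [h₁ fun n hn => h n (Or.inl hn), h₂ fun n hn => h n (Or.inr hn)]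
  | all _ ih => simp only [subst]; rw [ih (hup h)]
  | ex _ ih => simp only [subst]; rw [ih (hup h)]

theorem lift_subst_up (φ : Formula) (σ : ℕ → Tm) : φ.lift.subst (up σ) = (φ.subst σ).lift := by
  simp [lift, subst_subst]

theorem inst_subst (φ : Formula) (t : Tm) (σ : ℕ → Tm) :
    (φ.inst t).subst σ = (φ.subst (up σ)).inst (Term.subst t σ) := by
  simp only [inst, subst_subst]
  congr 1
  funext n
  cases n <;> simp [Term.subst_subst, Term.subst_bvar]

@[simp] theorem lift_inst (φ : Formula) (t : Tm) : φ.lift.inst t = φ := by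
  simp [lift, inst, subst_subst, subst_id]

/-- Instantiating a lifted formula at the fresh variable restores the body of the quantifier. -/
@[simp] theorem subst_up_shift_inst (φ : Formula) :
    (φ.subst (up fun n => bvar (n + 1))).inst (bvar 0) = φ := by
  simp only [inst, subst_subst]
  conv_rhs => rw [← subst_id φ]
  congr 1
  funext n
  cases n <;> simp

theorem succInst_subst (φ : Formula) (σ : ℕ → Tm) :
    φ.succInst.subst (up σ) = (φ.subst (up σ)).succInst := by
  simp only [succInst, subst_subst]
  congr 1
  funext n
  cases n <;> simp [Term.subst_subst]

@[simp] theorem lift_succInst (φ : Formula) : φ.lift.succInst = φ.lift := by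
  simp [lift, succInst, subst_subst]

end Formula

/-! ### Natural deduction -/

/-- A set of axioms closed under substitution of terms for free variables. -/
def SubstClosed (T : Set Formula) : Prop := ∀ φ ∈ T, ∀ σ, φ.subst σ ∈ T

theorem substClosed_HA : SubstClosed HA := by
  intro φ hφ σ
  cases hφ with
  | eqRefl t => exact .eqRefl _
  | eqSubst t s φ =>
    simp only [Formula.subst, Formula.inst_subst]
    exact .eqSubst _ _ _
  | succNeZero t =>
    simp only [Formula.subst, Formula.neg, subst_succTm, subst_zeroTm]
    exact .succNeZero _
  | succInj t s =>
    simp only [Formula.subst, subst_succTm]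
    exact .succInj _ _
  | projEq i ts => exact .projEq i _
  | compEq f g ts => exact .compEq f g _
  | precZero f g ts =>
    simp only [Formula.subst, subst_app, subst_vecCons, subst_zeroTm]
    exact .precZero f g _
  | precSucc f g t ts =>
    simp only [Formula.subst, subst_app, subst_vecCons, subst_succTm]
    exact .precSucc f g _ _
  | induction φ =>
    simp only [Formula.subst, Formula.inst_subst, Formula.succInst_subst, subst_zeroTm]
    exact .induction _

theorem SubstClosed.union {S T : Set Formula} (hS : SubstClosed S) (hT : SubstClosed T) :
    SubstClosed (S ∪ T) := fun φ h σ => h.imp (fun h => hS φ h σ) (fun h => hT φ h σ)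

theorem substClosed_PA : SubstClosed PA :=
  substClosed_HA.union (by rintro _ ⟨φ, rfl⟩ σ; exact ⟨φ.subst σ, rfl⟩)

theorem substClosed_classLEM (C : Set Formula) : SubstClosed (ClassLEM C) := by
  rintro _ ⟨φ, hC, hfv, rfl⟩ σ
  refine ⟨φ, hC, hfv, ?_⟩
  have h : φ.subst (up σ) = φ := by
    conv_rhs => rw [← φ.subst_id]
    refine φ.subst_congr fun n hn => ?_
    rw [hfv hn]
    rfl
  simp only [Formula.subst, Formula.neg, h]

namespace Prf

variable {T : Set Formula} {Γ Δ : List Formula} {φ ψ χ θ : Formula}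

theorem weaken (h : Prf T Γ φ) (hs : Γ ⊆ Δ) : Prf T Δ φ := by
  induction h generalizing Δ with
  | ax h => exact ax h
  | hyp h => exact hyp (hs h)
  | botE _ ih => exact botE (ih hs)
  | andI _ _ ih₁ ih₂ => exact andI (ih₁ hs) (ih₂ hs)
  | andE₁ _ ih => exact andE₁ (ih hs)
  | andE₂ _ ih => exact andE₂ (ih hs)
  | orI₁ _ ih => exact orI₁ (ih hs)
  | orI₂ _ ih => exact orI₂ (ih hs)
  | orE _ _ _ ih ih₁ ih₂ =>
    exact orE (ih hs) (ih₁ (List.cons_subset_cons _ hs)) (ih₂ (List.cons_subset_cons _ hs))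
  | impI _ ih => exact impI (ih (List.cons_subset_cons _ hs))
  | impE _ _ ih₁ ih₂ => exact impE (ih₁ hs) (ih₂ hs)
  | allI _ ih => exact allI (ih (List.map_subset _ hs))
  | allE t _ ih => exact allE t (ih hs)
  | exI t _ ih => exact exI t (ih hs)
  | exE _ _ ih₁ ih₂ =>
    exact exE (ih₁ hs) (ih₂ (List.cons_subset_cons _ (List.map_subset _ hs)))

theorem of_nil (h : Prf T [] φ) : Prf T Γ φ := h.weaken (List.nil_subset _)

theorem wk (h : Prf T Γ φ) : Prf T (ψ :: Γ) φ := h.weaken (List.subset_cons_self _ _)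

theorem subst (hT : SubstClosed T) (h : Prf T Γ φ) (σ : ℕ → Tm) :
    Prf T (Γ.map fun γ => γ.subst σ) (φ.subst σ) := by
  have hmap : ∀ (Γ : List Formula) σ, (Γ.map Formula.lift).map (fun γ => γ.subst (up σ)) =
      (Γ.map fun γ => γ.subst σ).map Formula.lift := by
    intro Γ σ
    simp only [List.map_map, Function.comp_def, Formula.lift_subst_up]
  induction h generalizing σ with
  | ax h => exact ax (hT _ h σ)
  | hyp h => exact hyp (List.mem_map_of_mem h)
  | botE _ ih => exact botE (ih σ)
  | andI _ _ ih₁ ih₂ => exact andI (ih₁ σ) (ih₂ σ)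
  | andE₁ _ ih => exact andE₁ (ih σ)
  | andE₂ _ ih => exact andE₂ (ih σ)
  | orI₁ _ ih => exact orI₁ (ih σ)
  | orI₂ _ ih => exact orI₂ (ih σ)
  | orE _ _ _ ih ih₁ ih₂ => exact orE (ih σ) (ih₁ σ) (ih₂ σ)
  | impI _ ih => exact impI (ih σ)
  | impE _ _ ih₁ ih₂ => exact impE (ih₁ σ) (ih₂ σ)
  | allI _ ih =>
    have := ih (up σ)
    rw [hmap] at this
    exact allI this
  | allE t _ ih =>
    rw [Formula.inst_subst]
    exact allE _ (ih σ)
  | exI t _ ih =>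
    have := ih σ
    rw [Formula.inst_subst] at this
    exact exI _ this
  | exE _ _ ih₁ ih₂ =>
    have := ih₂ (up σ)
    rw [List.map_cons, hmap, Formula.lift_subst_up] at this
    exact exE (ih₁ σ) this

theorem lift (hT : SubstClosed T) (h : Prf T Γ φ) : Prf T (Γ.map Formula.lift) φ.lift :=
  h.subst hT _

theorem hyp₀ : Prf T (φ :: Γ) φ := hyp (by simp)

theorem hyp₁ : Prf T (ψ :: φ :: Γ) φ := hyp (by simp)

theorem hyp₂ : Prf T (χ :: ψ :: φ :: Γ) φ := hyp (by simp)

theorem hyp₃ : Prf T (θ :: χ :: ψ :: φ :: Γ) φ := hyp (by simp)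

/-- Cut. -/
theorem cut (h : Prf T Γ φ) (h' : Prf T (φ :: Γ) ψ) : Prf T Γ ψ := impE (impI h') h

theorem impE_nil (h : Prf T [] (Formula.imp φ ψ)) (h' : Prf T Γ φ) : Prf T Γ ψ := impE h.of_nil h'

/-- Instantiation of a lifted universal formula at the fresh variable. -/
theorem allE₀ (h : Prf T Γ φ.all.lift) : Prf T Γ φ := by
  have := allE (bvar 0) h
  rwa [Formula.subst_up_shift_inst] at this

/-- Introduction of a lifted existential formula, the fresh variable being the witness. -/
theorem exI₀ (h : Prf T Γ φ) : Prf T Γ φ.ex.lift := by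
  refine exI (bvar 0) ?_
  rwa [Formula.subst_up_shift_inst]

end Prf

/-! ### Equality and induction in Heyting arithmetic -/

namespace Prf

variable {T : Set Formula} {Γ : List Formula} {φ : Formula} {t s r : Tm}

theorem eqRefl (hT : HA ⊆ T) (t : Tm) : Prf T Γ (.eq t t) := ax (hT (.eqRefl t))

theorem leibniz (hT : HA ⊆ T) (φ : Formula) (h : Prf T Γ (.eq t s)) (h' : Prf T Γ (φ.inst t)) :
    Prf T Γ (φ.inst s) := impE (impE (ax (hT (.eqSubst t s φ))) h) h'

theorem eqSymm (hT : HA ⊆ T) (h : Prf T Γ (.eq t s)) : Prf T Γ (.eq s t) := by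
  have := leibniz hT (.eq (bvar 0) (Term.subst t fun n => bvar (n + 1))) h
    (by simpa [Formula.inst, Formula.subst, Term.subst_subst, Term.subst_bvar] using eqRefl hT t)
  simpa [Formula.inst, Formula.subst, Term.subst_subst, Term.subst_bvar] using this

theorem eqTrans (hT : HA ⊆ T) (h : Prf T Γ (.eq t s)) (h' : Prf T Γ (.eq s r)) :
    Prf T Γ (.eq t r) := by
  have := leibniz hT (.eq (Term.subst t fun n => bvar (n + 1)) (bvar 0)) h'
    (by simpa [Formula.inst, Formula.subst, Term.subst_subst, Term.subst_bvar] using h)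
  simpa [Formula.inst, Formula.subst, Term.subst_subst, Term.subst_bvar] using this

theorem eqCongr (hT : HA ⊆ T) (r : Tm) (h : Prf T Γ (.eq t s)) :
    Prf T Γ (.eq (Term.subst r (Formula.instSubst t)) (Term.subst r (Formula.instSubst s))) := by
  have := leibniz hT
    (.eq (Term.subst (Term.subst r (Formula.instSubst t)) fun n => bvar (n + 1)) r) h
    (by simpa [Formula.inst, Formula.subst, Term.subst_subst, Term.subst_bvar] using eqRefl hT _)
  simpa [Formula.inst, Formula.subst, Term.subst_subst, Term.subst_bvar] using this

theorem eqSucc (hT : HA ⊆ T) (h : Prf T Γ (.eq t s)) : Prf T Γ (.eq (succTm t) (succTm s)) := by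
  simpa using eqCongr hT (succTm (bvar 0)) h

theorem succInj (hT : HA ⊆ T) (h : Prf T Γ (.eq (succTm t) (succTm s))) : Prf T Γ (.eq t s) :=
  impE (ax (hT (.succInj t s))) h

theorem succNeZero (hT : HA ⊆ T) (h : Prf T Γ (.eq (succTm t) zeroTm)) : Prf T Γ φ :=
  botE (impE (ax (hT (.succNeZero t))) h)

theorem zeroNeSucc (hT : HA ⊆ T) (h : Prf T Γ (.eq zeroTm (succTm t))) : Prf T Γ φ :=
  succNeZero hT (eqSymm hT h)

theorem ind (hT : HA ⊆ T) (h₀ : Prf T Γ (φ.inst zeroTm))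
    (h₁ : Prf T (φ :: Γ.map Formula.lift) φ.succInst) : Prf T Γ φ.all :=
  impE (impE (ax (hT (.induction φ))) h₀) (allI (impI h₁))

theorem cases (hT : HA ⊆ T) (h₀ : Prf T Γ (φ.inst zeroTm))
    (h₁ : Prf T (Γ.map Formula.lift) φ.succInst) : Prf T Γ φ.all := ind hT h₀ h₁.wk

/-- Decidability of equality, by induction on `t` with a case distinction on `s`. -/
theorem eq_or_ne (hT : HA ⊆ T) (t s : Tm) :
    Prf T Γ ((Formula.eq t s).or (Formula.eq t s).neg) := by
  have h : Prf T [] (.all (.all ((Formula.eq (bvar 1) (bvar 0)).or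
      (Formula.eq (bvar 1) (bvar 0)).neg))) := by
    refine ind hT (cases hT ?_ ?_) (cases hT ?_ ?_) <;>
      simp only [Formula.inst, Formula.succInst, Formula.lift, Formula.subst, Formula.neg,
        List.map_cons, List.map_nil, subst_bvar, up_zero, up_succ, instSubst_zero,
        instSubst_succ, subst_zeroTm, subst_succTm, zero_add, Nat.reduceAdd]
    · exact orI₁ (eqRefl hT _)
    · exact orI₂ (impI (zeroNeSucc hT hyp₀))
    · exact orI₂ (impI (succNeZero hT hyp₀))
    · refine orE (allE (bvar 0) hyp₀) (orI₁ (eqSucc hT ?_)) (orI₂ (impI (impE ?_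
        (succInj hT hyp₀))))
      · exact hyp₀
      · exact hyp₁
  simpa [Formula.inst, Formula.subst, Formula.neg, Term.subst_subst, Term.subst_bvar] using
    allE s (allE t (h.of_nil (Γ := Γ)))

end Prf

/-! ### An injective pairing function -/

/-- The function symbol of doubling. In the recursion step, `proj 1` is the previous value. -/
def dbl : PRSymb 1 := .prec .zero (.comp .succ fun _ => .comp .succ fun _ => .proj 1)

/-- The function symbol of the pairing function `2 ^ x * (2 * y + 1)`, defined by recursion
on `x`. -/
def pair : PRSymb 2 := .prec (.comp .succ fun _ => dbl) (.comp dbl fun _ => .proj 1)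

/-- The term `2 * t`. -/
def dblTm (t : Tm) : Tm := app dbl ![t]

/-- The term `2 ^ t * (2 * s + 1)`. -/
def pairTm (t s : Tm) : Tm := app pair ![t, s]

@[simp] theorem subst_dblTm (t : Tm) (σ : ℕ → Tm) :
    Term.subst (dblTm t) σ = dblTm (Term.subst t σ) := by
  simp only [dblTm, subst_app, subst_vecCons, subst_vecEmpty]

@[simp] theorem subst_pairTm (t s : Tm) (σ : ℕ → Tm) :
    Term.subst (pairTm t s) σ = pairTm (Term.subst t σ) (Term.subst s σ) := by
  simp only [pairTm, subst_app, subst_vecCons, subst_vecEmpty]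

namespace Prf

variable {T : Set Formula} {Γ : List Formula} {φ : Formula} {t s t' s' : Tm}

theorem eqDbl (hT : HA ⊆ T) (h : Prf T Γ (.eq t s)) : Prf T Γ (.eq (dblTm t) (dblTm s)) := by
  simpa using eqCongr hT (dblTm (bvar 0)) h

theorem comp_eq (hT : HA ⊆ T) {n : ℕ} (f : PRSymb 1) (g : PRSymb n) (ts : Fin n → Tm) :
    Prf T Γ (.eq (app (.comp f fun _ => g) ts) (app f ![app g ts])) := by
  have h : ![app g ts] = fun _ => app g ts := by
    funext i
    fin_cases i
    rfl
  rw [h]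
  exact ax (hT (.compEq f (fun _ => g) ts))

theorem dbl_zero (hT : HA ⊆ T) : Prf T Γ (.eq (dblTm zeroTm) zeroTm) :=
  ax (hT (.precZero _ _ ![]))

theorem dbl_succ (hT : HA ⊆ T) (t : Tm) :
    Prf T Γ (.eq (dblTm (succTm t)) (succTm (succTm (dblTm t)))) :=
  eqTrans hT (ax (hT (.precSucc _ _ t ![]))) <| eqTrans hT (comp_eq hT _ _ _) <|
    eqSucc hT <| eqTrans hT (comp_eq hT _ _ _) <| eqSucc hT <| ax (hT (.projEq 1 _))

theorem pair_zero (hT : HA ⊆ T) (s : Tm) :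
    Prf T Γ (.eq (pairTm zeroTm s) (succTm (dblTm s))) :=
  eqTrans hT (ax (hT (.precZero _ _ ![s]))) (comp_eq hT _ _ _)

theorem pair_succ (hT : HA ⊆ T) (t s : Tm) :
    Prf T Γ (.eq (pairTm (succTm t) s) (dblTm (pairTm t s))) :=
  eqTrans hT (ax (hT (.precSucc _ _ t ![s]))) <| eqTrans hT (comp_eq hT _ _ _) <|
    eqDbl hT <| ax (hT (.projEq 1 _))

theorem dbl_inj (hT : HA ⊆ T) (h : Prf T Γ (.eq (dblTm t) (dblTm s))) : Prf T Γ (.eq t s) := by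
  have key : Prf T [] (.all (.all (.imp (.eq (dblTm (bvar 1)) (dblTm (bvar 0)))
      (.eq (bvar 1) (bvar 0))))) := by
    refine ind hT (cases hT ?_ ?_) (cases hT ?_ ?_) <;>
      simp only [Formula.inst, Formula.succInst, Formula.lift, Formula.subst,
        List.map_cons, List.map_nil, subst_bvar, up_zero, up_succ, instSubst_zero,
        instSubst_succ, subst_zeroTm, subst_succTm, zero_add, Nat.reduceAdd, subst_dblTm] <;>
      refine impI ?_
    · exact eqRefl hT _
    · exact zeroNeSucc hT (eqTrans hT (eqSymm hT (dbl_zero hT)) (eqTrans hT hyp₀ (dbl_succ hT _)))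
    · exact succNeZero hT (eqTrans hT (eqSymm hT (dbl_succ hT _)) (eqTrans hT hyp₀ (dbl_zero hT)))
    · refine cut (allE (bvar 0) hyp₁) ?_
      simp only [Formula.inst, Formula.subst, subst_bvar, instSubst_zero,
        instSubst_succ, subst_dblTm]
      refine eqSucc hT (impE hyp₀ ?_)
      exact succInj hT (succInj hT (eqTrans hT (eqSymm hT (dbl_succ hT _))
        (eqTrans hT hyp₁ (dbl_succ hT (bvar 0)))))
  have := allE s (allE t (key.of_nil (Γ := Γ)))
  simp [Formula.inst, Formula.subst, Term.subst_subst, Term.subst_bvar] at this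
  exact impE this h

/-- No number is both even and odd. -/
theorem dbl_ne_succ_dbl (hT : HA ⊆ T) (h : Prf T Γ (.eq (dblTm t) (succTm (dblTm s)))) :
    Prf T Γ φ := by
  have key : Prf T [] (.all (.all (Formula.neg (.eq (dblTm (bvar 1))
      (succTm (dblTm (bvar 0))))))) := by
    refine ind hT (allI ?_) (cases hT ?_ ?_) <;>
      simp only [Formula.inst, Formula.succInst, Formula.lift, Formula.subst, Formula.neg,
        List.map_cons, List.map_nil, subst_bvar, up_zero, up_succ, instSubst_zero,
        instSubst_succ, subst_zeroTm, subst_succTm, zero_add, Nat.reduceAdd, subst_dblTm] <;>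
      refine impI ?_
    · exact zeroNeSucc hT (eqTrans hT (eqSymm hT (dbl_zero hT)) hyp₀)
    · exact succNeZero hT (succInj hT (eqTrans hT (eqSymm hT (dbl_succ hT _)) (eqTrans hT hyp₀
        (eqSucc hT (dbl_zero hT)))))
    · refine cut (allE (bvar 0) hyp₁) ?_
      simp only [Formula.inst, Formula.subst, subst_succTm,
        subst_bvar, instSubst_zero, instSubst_succ, subst_dblTm]
      refine impE hyp₀ ?_
      exact succInj hT (succInj hT (eqTrans hT (eqSymm hT (dbl_succ hT _))
        (eqTrans hT hyp₁ (eqSucc hT (dbl_succ hT (bvar 0))))))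
  have := allE s (allE t (key.of_nil (Γ := Γ)))
  simp [Formula.inst, Formula.subst, Formula.neg, Term.subst_subst, Term.subst_bvar] at this
  exact botE (impE this h)

/-- Injectivity of pairing, by induction on `t` with a case distinction on `t'`. If one first
component is zero and the other is not, the two codes have different parity. -/
theorem pair_inj (hT : HA ⊆ T) (h : Prf T Γ (.eq (pairTm t s) (pairTm t' s'))) :
    Prf T Γ (.and (.eq t t') (.eq s s')) := by
  have key : Prf T [] (.all (.all (.all (.all (.imp
      (.eq (pairTm (bvar 3) (bvar 1)) (pairTm (bvar 2) (bvar 0)))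
      (.and (.eq (bvar 3) (bvar 2)) (.eq (bvar 1) (bvar 0)))))))) := by
    refine ind hT (cases hT (allI (allI ?_)) (allI (allI ?_)))
      (cases hT (allI (allI ?_)) (allI (allI ?_))) <;>
      simp only [Formula.lift, Formula.subst,
        List.map_cons, List.map_nil, subst_bvar, up_zero, up_succ, instSubst_zero,
        instSubst_succ, subst_zeroTm, subst_succTm, zero_add, Nat.reduceAdd, subst_pairTm] <;>
      refine impI ?_
    · exact andI (eqRefl hT _) (dbl_inj hT (succInj hT (eqTrans hT (eqSymm hT (pair_zero hT _))
        (eqTrans hT hyp₀ (pair_zero hT _)))))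
    · exact dbl_ne_succ_dbl hT (eqTrans hT (eqSymm hT (pair_succ hT _ _))
        (eqTrans hT (eqSymm hT hyp₀) (pair_zero hT _)))
    · exact dbl_ne_succ_dbl hT (eqTrans hT (eqSymm hT (pair_succ hT _ _))
        (eqTrans hT hyp₀ (pair_zero hT _)))
    · refine cut (allE (bvar 2) hyp₁) (cut (allE (bvar 1) hyp₀) (cut (allE (bvar 0) hyp₀) ?_))
      simp only [Formula.inst, Formula.subst, up_zero, up_succ, subst_bvar, instSubst_zero,
        instSubst_succ, subst_pairTm, zero_add, Nat.reduceAdd]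
      refine cut (impE hyp₀ (dbl_inj hT ?_)) (andI (eqSucc hT (andE₁ hyp₀)) (andE₂ hyp₀))
      exact eqTrans hT (eqSymm hT (pair_succ hT _ _))
        (eqTrans hT hyp₃ (pair_succ hT (bvar 2) (bvar 0)))
  have := allE s' (allE s (allE t' (allE t (key.of_nil (Γ := Γ)))))
  simp [Formula.inst, Formula.subst, Term.subst_subst, Term.subst_bvar] at this
  exact impE this h

end Prf

/-! ### The negative translation relative to a formula -/

namespace Formula

/-- Double negation relative to `ρ`, i.e. `(φ → ρ) → ρ`. -/
def dneg (ρ φ : Formula) : Formula := imp (imp φ ρ) ρ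

/-- The Gödel–Gentzen translation of a formula, with `ρ` in the place of falsity. The formula `ρ`
is lifted under quantifiers, so that its free variables are not captured. -/
def trans : Formula → Formula → Formula
  | bot, ρ => ρ
  | eq t s, ρ => dneg ρ (eq t s)
  | and φ ψ, ρ => and (φ.trans ρ) (ψ.trans ρ)
  | or φ ψ, ρ => dneg ρ (or (φ.trans ρ) (ψ.trans ρ))
  | imp φ ψ, ρ => imp (φ.trans ρ) (ψ.trans ρ)
  | all φ, ρ => all (φ.trans ρ.lift)
  | ex φ, ρ => dneg ρ (ex (φ.trans ρ.lift))

theorem trans_subst (φ ρ : Formula) (σ : ℕ → Tm) :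
    (φ.trans ρ).subst σ = (φ.subst σ).trans (ρ.subst σ) := by
  induction φ generalizing ρ σ with
  | bot => rfl
  | eq t s => rfl
  | and _ _ h₁ h₂ => simp only [trans, subst, h₁, h₂]
  | or _ _ h₁ h₂ => simp only [trans, dneg, subst, h₁, h₂]
  | imp _ _ h₁ h₂ => simp only [trans, subst, h₁, h₂]
  | all _ h => simp only [trans, subst, h, lift_subst_up]
  | ex _ h => simp only [trans, dneg, subst, h, lift_subst_up]

theorem trans_lift (φ ρ : Formula) : φ.lift.trans ρ.lift = (φ.trans ρ).lift :=
  (trans_subst φ ρ _).symm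

theorem trans_inst (φ ρ : Formula) (t : Tm) :
    (φ.inst t).trans ρ = (φ.trans ρ.lift).inst t := by
  rw [inst, inst, trans_subst]
  exact congrArg _ (lift_inst ρ t).symm

theorem trans_succInst (φ ρ : Formula) :
    φ.succInst.trans ρ.lift = (φ.trans ρ.lift).succInst := by
  conv_lhs => rw [← lift_succInst ρ]
  exact (trans_subst φ ρ.lift _).symm

end Formula

namespace Prf

variable {T : Set Formula} {Γ : List Formula} {φ ψ ρ : Formula}

theorem dnegI (h : Prf T Γ φ) : Prf T Γ (Formula.dneg ρ φ) :=
  impI (impE hyp₀ h.wk)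

/-- Translated formulas are stable under the relative double negation. -/
theorem trans_stable_aux (φ ρ : Formula) (Γ : List Formula) :
    Prf T (Formula.dneg ρ (φ.trans ρ) :: Γ) (φ.trans ρ) := by
  have hdn : ∀ {ρ ψ Γ}, Prf T (Formula.dneg ρ (Formula.dneg ρ ψ) :: Γ) (Formula.dneg ρ ψ) :=
    impI (impE hyp₁ (impI (impE hyp₀ hyp₁)))
  induction φ generalizing ρ Γ with
  | bot => exact impE hyp₀ (impI hyp₀)
  | eq t s => exact hdn
  | and φ ψ h₁ h₂ =>
    exact andI (cut (impI (impE hyp₁ (impI (impE hyp₁ (andE₁ hyp₀))))) (h₁ ρ _))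
      (cut (impI (impE hyp₁ (impI (impE hyp₁ (andE₂ hyp₀))))) (h₂ ρ _))
  | or φ ψ h₁ h₂ => exact hdn
  | imp φ ψ h₁ h₂ =>
    exact impI (cut (impI (impE hyp₂ (impI (impE hyp₁ (impE hyp₀ hyp₂))))) (h₂ ρ _))
  | all φ h =>
    refine allI (cut (impI ?_) (h ρ.lift _))
    have h₁ : Prf T ((φ.trans ρ.lift).imp ρ.lift ::
        List.map Formula.lift (Formula.dneg ρ (φ.all.trans ρ) :: Γ))
        (.imp (.imp (φ.all.trans ρ).lift ρ.lift) ρ.lift) := hyp₁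
    exact impE h₁ (impI (impE hyp₁ (allE₀ hyp₀)))
  | ex φ h => exact hdn

theorem trans_stable (h : Prf T Γ (Formula.dneg ρ (φ.trans ρ))) : Prf T Γ (φ.trans ρ) :=
  cut h (trans_stable_aux φ ρ Γ)

theorem trans_exfalso (h : Prf T Γ ρ) : Prf T Γ (φ.trans ρ) := trans_stable (impI h.wk)

/-- To derive a translated formula, a relative double negation may be dropped from an
assumption. -/
theorem dnegE (h : Prf T Γ (Formula.dneg ρ ψ)) (h' : Prf T (ψ :: Γ) (φ.trans ρ)) :
    Prf T Γ (φ.trans ρ) :=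
  trans_stable (impI (impE h.wk (impI (impE hyp₁ (h'.weaken
    (List.cons_subset_cons _ (List.subset_cons_self _ _)))))))

/-- Soundness of the translation: it turns classical proofs into intuitionistic ones. -/
theorem trans (hT : HA ⊆ T) (h : Prf PA Γ φ) (ρ : Formula) :
    Prf T (Γ.map fun γ => γ.trans ρ) (φ.trans ρ) := by
  have hmap : ∀ (Γ : List Formula) (ρ : Formula),
      (Γ.map Formula.lift).map (fun γ => γ.trans ρ.lift) =
      (Γ.map fun γ => γ.trans ρ).map Formula.lift := by
    intro Γ ρ
    simp only [List.map_map, Function.comp_def, Formula.trans_lift]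
  induction h generalizing ρ with
  | ax h =>
    rcases h with h | ⟨φ, rfl⟩
    · cases h with
      | eqRefl t => exact dnegI (eqRefl hT t)
      | eqSubst t s φ =>
        -- The conclusion is a translated formula, so the double negation of `t = s` may be dropped.
        refine impI (impI (dnegE hyp₁ ?_))
        rw [Formula.trans_inst, Formula.trans_inst]
        exact leibniz hT _ hyp₀ hyp₁
      | succNeZero t => exact impI (impE hyp₀ (impI (succNeZero hT hyp₀)))
      | succInj t s =>
        exact impI (impI (impE hyp₁ (impI (impE hyp₁ (succInj hT hyp₀)))))
      | projEq i ts => exact dnegI (ax (hT (.projEq i ts)))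
      | compEq f g ts => exact dnegI (ax (hT (.compEq f g ts)))
      | precZero f g ts => exact dnegI (ax (hT (.precZero f g ts)))
      | precSucc f g t ts => exact dnegI (ax (hT (.precSucc f g t ts)))
      | induction φ =>
        simp only [Formula.trans, Formula.trans_inst, Formula.trans_succInst]
        exact ax (hT (.induction _))
    · exact impI (impE hyp₀ (orI₂ (impI (impE hyp₁ (orI₁ hyp₀)))))
  | hyp h => exact hyp (List.mem_map_of_mem h)
  | botE _ ih => exact trans_exfalso (ih ρ)
  | andI _ _ ih₁ ih₂ => exact andI (ih₁ ρ) (ih₂ ρ)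
  | andE₁ _ ih => exact andE₁ (ih ρ)
  | andE₂ _ ih => exact andE₂ (ih ρ)
  | orI₁ _ ih => exact dnegI (orI₁ (ih ρ))
  | orI₂ _ ih => exact dnegI (orI₂ (ih ρ))
  | orE _ _ _ ih ih₁ ih₂ =>
    exact dnegE (ih ρ) (orE hyp₀
      ((ih₁ ρ).weaken (List.cons_subset_cons _ (List.subset_cons_self _ _)))
      ((ih₂ ρ).weaken (List.cons_subset_cons _ (List.subset_cons_self _ _))))
  | impI _ ih => exact impI (ih ρ)
  | impE _ _ ih₁ ih₂ => exact impE (ih₁ ρ) (ih₂ ρ)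
  | allI _ ih =>
    have := ih ρ.lift
    rw [hmap] at this
    exact allI this
  | allE t _ ih =>
    rw [Formula.trans_inst]
    exact allE t (ih ρ)
  | exI t _ ih =>
    have := ih ρ
    rw [Formula.trans_inst] at this
    exact dnegI (exI t this)
  | exE _ _ ih₁ ih₂ =>
    have := ih₂ ρ.lift
    rw [List.map_cons, hmap, Formula.trans_lift] at this
    exact dnegE (ih₁ ρ) (exE hyp₀ (this.weaken (List.cons_subset_cons _
      (List.subset_cons_self _ _))))

end Prf

/-! ### Free variables -/

theorem Term.exists_of_mem_varFinset_subst {t : Tm} {σ : ℕ → Tm} {m : ℕ}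
    (h : m ∈ (Term.subst t σ).varFinset) : ∃ n ∈ t.varFinset, m ∈ (σ n).varFinset := by
  induction t with
  | var n => exact ⟨n, by simp [Term.varFinset], h⟩
  | func f ts ih =>
    simp only [Term.subst, Term.varFinset, Finset.mem_biUnion, Finset.mem_univ, true_and] at h ⊢
    obtain ⟨i, hi⟩ := h
    obtain ⟨n, hn, hm⟩ := ih i hi
    exact ⟨n, ⟨i, hn⟩, hm⟩

namespace Formula

theorem exists_of_mem_fv_subst {φ : Formula} {σ : ℕ → Tm} {m : ℕ}
    (h : m ∈ (φ.subst σ).fv) : ∃ n ∈ φ.fv, m ∈ (σ n).varFinset := by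
  have hup : ∀ {s : Set ℕ} {σ : ℕ → Tm} {m : ℕ}, (∃ n ∈ s, m + 1 ∈ (up σ n).varFinset) →
      ∃ n ∈ {n | n + 1 ∈ s}, m ∈ (σ n).varFinset := by
    rintro s σ m ⟨n, hn, hm⟩
    cases n with
    | zero => simp [bvar, Term.varFinset] at hm
    | succ n =>
      rw [up_succ] at hm
      obtain ⟨l, hl, hm⟩ := Term.exists_of_mem_varFinset_subst hm
      simp only [bvar, Term.varFinset, Finset.mem_singleton, Nat.add_right_cancel_iff] at hm
      exact ⟨n, hn, hm ▸ hl⟩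
  induction φ generalizing σ m with
  | bot => exact h.elim
  | eq t s =>
    rcases h with h | h
    · obtain ⟨n, hn, hm⟩ := Term.exists_of_mem_varFinset_subst h
      exact ⟨n, Or.inl hn, hm⟩
    · obtain ⟨n, hn, hm⟩ := Term.exists_of_mem_varFinset_subst h
      exact ⟨n, Or.inr hn, hm⟩
  | and φ ψ h₁ h₂ | or φ ψ h₁ h₂ | imp φ ψ h₁ h₂ =>
    rcases h with h | h
    · obtain ⟨n, hn, hm⟩ := h₁ h
      exact ⟨n, Or.inl hn, hm⟩
    · obtain ⟨n, hn, hm⟩ := h₂ h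
      exact ⟨n, Or.inr hn, hm⟩
  | all φ ih | ex φ ih => exact hup (ih h)

theorem exists_fv_lt (φ : Formula) : ∃ b, ∀ m ∈ φ.fv, m < b := by
  induction φ with
  | bot => exact ⟨0, fun _ h => h.elim⟩
  | eq t s =>
    refine ⟨(t.varFinset ∪ s.varFinset).sup id + 1, fun m hm => Nat.lt_succ_of_le ?_⟩
    exact Finset.le_sup (f := id) (Finset.mem_union.2 hm)
  | and φ ψ h₁ h₂ | or φ ψ h₁ h₂ | imp φ ψ h₁ h₂ =>
    obtain ⟨a, ha⟩ := h₁
    obtain ⟨b, hb⟩ := h₂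
    exact ⟨max a b, fun m hm => hm.elim (fun h => lt_max_of_lt_left (ha m h))
      (fun h => lt_max_of_lt_right (hb m h))⟩
  | all φ ih | ex φ ih =>
    obtain ⟨b, hb⟩ := ih
    exact ⟨b, fun m hm => (Nat.lt_succ_self m).trans (hb _ hm)⟩

end Formula

/-! ### Prenex classes -/

theorem PiClass_subset_SigmaClass_succ (k : ℕ) : PiClass k ⊆ SigmaClass (k + 1) := by
  intro φ h
  rw [SigmaClass]
  exact ⟨0, φ, h, rfl⟩

theorem SigmaClass_subset_PiClass_succ (k : ℕ) : SigmaClass k ⊆ PiClass (k + 1) := by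
  intro φ h
  rw [PiClass]
  exact ⟨0, φ, h, rfl⟩

theorem ex_mem_SigmaClass {k : ℕ} {φ : Formula} (h : φ ∈ SigmaClass (k + 1)) :
    φ.ex ∈ SigmaClass (k + 1) := by
  rw [SigmaClass] at h ⊢
  obtain ⟨n, φ, h, rfl⟩ := h
  exact ⟨n + 1, φ, h, (Function.iterate_succ_apply' _ _ _).symm⟩

theorem all_mem_PiClass {k : ℕ} {φ : Formula} (h : φ ∈ PiClass (k + 1)) :
    φ.all ∈ PiClass (k + 1) := by
  rw [PiClass] at h ⊢
  obtain ⟨n, φ, h, rfl⟩ := h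
  exact ⟨n + 1, φ, h, (Function.iterate_succ_apply' _ _ _).symm⟩

theorem SigmaClass_succ_induction {k : ℕ} {P : Formula → Prop} (h₀ : ∀ φ ∈ PiClass k, P φ)
    (h₁ : ∀ φ ∈ SigmaClass (k + 1), P φ → P φ.ex) : ∀ φ ∈ SigmaClass (k + 1), P φ := by
  intro φ h
  rw [SigmaClass] at h
  obtain ⟨n, φ, h, rfl⟩ := h
  induction n with
  | zero => exact h₀ φ h
  | succ n ih =>
    rw [Function.iterate_succ_apply']
    refine h₁ _ ?_ ih
    rw [SigmaClass]
    exact ⟨n, φ, h, rfl⟩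

theorem PiClass_succ_induction {k : ℕ} {P : Formula → Prop} (h₀ : ∀ φ ∈ SigmaClass k, P φ)
    (h₁ : ∀ φ ∈ PiClass (k + 1), P φ → P φ.all) : ∀ φ ∈ PiClass (k + 1), P φ := by
  intro φ h
  rw [PiClass] at h
  obtain ⟨n, φ, h, rfl⟩ := h
  induction n with
  | zero => exact h₀ φ h
  | succ n ih =>
    rw [Function.iterate_succ_apply']
    refine h₁ _ ?_ ih
    rw [PiClass]
    exact ⟨n, φ, h, rfl⟩

/-- Simultaneous induction along the classes `Σ_k` and `Π_k`, one quantifier at a time. -/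
theorem prenexClass_induction {P Q : ℕ → Formula → Prop}
    (hP₀ : ∀ φ, φ.QF → P 0 φ) (hQ₀ : ∀ φ, φ.QF → Q 0 φ)
    (hP₁ : ∀ k φ, Q k φ → P (k + 1) φ) (hQ₁ : ∀ k φ, P k φ → Q (k + 1) φ)
    (hP₂ : ∀ k φ, P (k + 1) φ → P (k + 1) φ.ex)
    (hQ₂ : ∀ k φ, Q (k + 1) φ → Q (k + 1) φ.all) (k : ℕ) :
    (∀ φ ∈ SigmaClass k, P k φ) ∧ (∀ φ ∈ PiClass k, Q k φ) := by
  induction k with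
  | zero =>
    simp only [SigmaClass, PiClass]
    exact ⟨hP₀, hQ₀⟩
  | succ k ih =>
    exact ⟨SigmaClass_succ_induction (fun φ h => hP₁ k φ (ih.2 φ h)) fun φ _ => hP₂ k φ,
      PiClass_succ_induction (fun φ h => hQ₁ k φ (ih.1 φ h)) fun φ _ => hQ₂ k φ⟩

theorem Formula.QF.subst {φ : Formula} (h : φ.QF) (σ : ℕ → Tm) : (φ.subst σ).QF := by
  induction φ with
  | bot | eq => trivial
  | and _ _ h₁ h₂ | or _ _ h₁ h₂ | imp _ _ h₁ h₂ => exact ⟨h₁ h.1, h₂ h.2⟩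
  | all | ex => exact h.elim

theorem QF_mem_SigmaClass {φ : Formula} (h : φ.QF) : φ ∈ SigmaClass 0 := by
  rw [SigmaClass]
  exact h

theorem QF_mem_PiClass {φ : Formula} (h : φ.QF) : φ ∈ PiClass 0 := by
  rw [PiClass]
  exact h

theorem prenexClass_subset_succ (k : ℕ) :
    SigmaClass k ⊆ SigmaClass (k + 1) ∧ PiClass k ⊆ PiClass (k + 1) :=
  prenexClass_induction (P := fun k φ => φ ∈ SigmaClass (k + 1))
    (Q := fun k φ => φ ∈ PiClass (k + 1))
    (fun _ h => PiClass_subset_SigmaClass_succ _ (QF_mem_PiClass h))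
    (fun _ h => SigmaClass_subset_PiClass_succ _ (QF_mem_SigmaClass h))
    (fun _ _ h => PiClass_subset_SigmaClass_succ _ h)
    (fun _ _ h => SigmaClass_subset_PiClass_succ _ h)
    (fun _ _ h => ex_mem_SigmaClass h) (fun _ _ h => all_mem_PiClass h) k

theorem SigmaClass_mono : Monotone SigmaClass :=
  monotone_nat_of_le_succ fun k => (prenexClass_subset_succ k).1

theorem subst_mem_prenexClass (k : ℕ) :
    (∀ φ ∈ SigmaClass k, ∀ σ, φ.subst σ ∈ SigmaClass k) ∧
      (∀ φ ∈ PiClass k, ∀ σ, φ.subst σ ∈ PiClass k) :=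
  prenexClass_induction (P := fun k φ => ∀ σ, φ.subst σ ∈ SigmaClass k)
    (Q := fun k φ => ∀ σ, φ.subst σ ∈ PiClass k)
    (fun _ h σ => QF_mem_SigmaClass (h.subst σ)) (fun _ h σ => QF_mem_PiClass (h.subst σ))
    (fun _ _ h σ => PiClass_subset_SigmaClass_succ _ (h σ))
    (fun _ _ h σ => SigmaClass_subset_PiClass_succ _ (h σ))
    (fun _ _ h σ => ex_mem_SigmaClass (h (up σ))) (fun _ _ h σ => all_mem_PiClass (h (up σ))) k

namespace Formula

/-- The dual of a prenex formula: quantifiers are exchanged and the quantifier-free matrix is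
negated. -/
def dual : Formula → Formula
  | all φ => ex φ.dual
  | ex φ => all φ.dual
  | bot => neg bot
  | eq t s => neg (eq t s)
  | and φ ψ => neg (and φ ψ)
  | or φ ψ => neg (or φ ψ)
  | imp φ ψ => neg (imp φ ψ)

theorem QF.dual_eq {φ : Formula} (h : φ.QF) : φ.dual = φ.neg := by
  cases φ with
  | all | ex => exact h.elim
  | _ => rfl

/-- Conjunction with `α`, placed in front of the matrix of a prenex formula. -/
def guard : Formula → Formula → Formula
  | α, all φ => all (guard α.lift φ)
  | α, ex φ => ex (guard α.lift φ)
  | α, bot => and α bot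
  | α, eq t s => and α (eq t s)
  | α, and φ ψ => and α (and φ ψ)
  | α, or φ ψ => and α (or φ ψ)
  | α, imp φ ψ => and α (imp φ ψ)

theorem QF.guard_eq {φ : Formula} (h : φ.QF) (α : Formula) : guard α φ = and α φ := by
  cases φ with
  | all | ex => exact h.elim
  | _ => rfl

theorem guard_subst (α φ : Formula) (σ : ℕ → Tm) :
    (guard α φ).subst σ = guard (α.subst σ) (φ.subst σ) := by
  induction φ generalizing α σ with
  | all _ ih | ex _ ih => simp only [guard, subst, ih, lift_subst_up]
  | _ => rfl

theorem fv_guard (α φ : Formula) : (guard α φ).fv ⊆ α.fv ∪ φ.fv := by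
  induction φ generalizing α with
  | all φ ih | ex φ ih =>
    intro m hm
    rcases ih α.lift hm with h | h
    · obtain ⟨n, hn, h⟩ := exists_of_mem_fv_subst h
      simp only [bvar, Term.varFinset, Finset.mem_singleton, Nat.add_right_cancel_iff] at h
      exact Or.inl (h ▸ hn)
    · exact Or.inr h
  | _ => exact subset_rfl

/-- Formulas consisting of a string of quantifiers in front of a quantifier-free matrix. -/
inductive Prenex : Formula → Prop
  | qf {φ} : φ.QF → Prenex φ
  | all {φ} : Prenex φ → Prenex φ.all
  | ex {φ} : Prenex φ → Prenex φ.ex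

theorem Prenex.subst {φ : Formula} (h : φ.Prenex) (σ : ℕ → Tm) : (φ.subst σ).Prenex := by
  induction h generalizing σ with
  | qf h => exact .qf (h.subst σ)
  | all _ ih => exact .all (ih _)
  | ex _ ih => exact .ex (ih _)

end Formula

theorem prenex_of_mem_prenexClass (k : ℕ) :
    (∀ φ ∈ SigmaClass k, φ.Prenex) ∧ (∀ φ ∈ PiClass k, φ.Prenex) :=
  prenexClass_induction (P := fun _ φ => φ.Prenex) (Q := fun _ φ => φ.Prenex)
    (fun _ => .qf) (fun _ => .qf) (fun _ _ h => h) (fun _ _ h => h)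
    (fun _ _ => .ex) (fun _ _ => .all) k

theorem IsPrenex.prenex {φ : Formula} (h : IsPrenex φ) : φ.Prenex := by
  obtain ⟨k, h | h⟩ := h
  · exact (prenex_of_mem_prenexClass k).1 φ h
  · exact (prenex_of_mem_prenexClass k).2 φ h

theorem dual_mem_prenexClass (k : ℕ) :
    (∀ φ ∈ SigmaClass k, φ.dual ∈ PiClass k) ∧ (∀ φ ∈ PiClass k, φ.dual ∈ SigmaClass k) :=
  prenexClass_induction (P := fun k φ => φ.dual ∈ PiClass k)
    (Q := fun k φ => φ.dual ∈ SigmaClass k)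
    (fun _ h => h.dual_eq ▸ QF_mem_PiClass ⟨h, trivial⟩)
    (fun _ h => h.dual_eq ▸ QF_mem_SigmaClass ⟨h, trivial⟩)
    (fun _ _ h => SigmaClass_subset_PiClass_succ _ h)
    (fun _ _ h => PiClass_subset_SigmaClass_succ _ h)
    (fun _ _ h => all_mem_PiClass h) (fun _ _ h => ex_mem_SigmaClass h) k

theorem guard_mem_prenexClass (k : ℕ) :
    (∀ φ ∈ SigmaClass k, ∀ α : Formula, α.QF → Formula.guard α φ ∈ SigmaClass k) ∧
      (∀ φ ∈ PiClass k, ∀ α : Formula, α.QF → Formula.guard α φ ∈ PiClass k) :=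
  prenexClass_induction
    (P := fun k φ => ∀ α : Formula, α.QF → Formula.guard α φ ∈ SigmaClass k)
    (Q := fun k φ => ∀ α : Formula, α.QF → Formula.guard α φ ∈ PiClass k)
    (fun _ h α hα => h.guard_eq α ▸ QF_mem_SigmaClass ⟨hα, h⟩)
    (fun _ h α hα => h.guard_eq α ▸ QF_mem_PiClass ⟨hα, h⟩)
    (fun _ _ h α hα => PiClass_subset_SigmaClass_succ _ (h α hα))
    (fun _ _ h α hα => SigmaClass_subset_PiClass_succ _ (h α hα))
    (fun _ _ h _ hα => ex_mem_SigmaClass (h _ (hα.subst _)))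
    (fun _ _ h _ hα => all_mem_PiClass (h _ (hα.subst _))) k

/-! ### Provability of prenex formulas and their translations -/

namespace Prf

variable {T : Set Formula} {φ : Formula}

theorem qf_or_neg (hT : HA ⊆ T) (h : φ.QF) (Γ : List Formula) : Prf T Γ (φ.or φ.neg) := by
  induction φ generalizing Γ with
  | bot => exact orI₂ (impI hyp₀)
  | eq t s => exact eq_or_ne hT t s
  | and φ ψ h₁ h₂ =>
    exact orE (h₁ h.1 _) (orE (h₂ h.2 _) (orI₁ (andI hyp₁ hyp₀))
      (orI₂ (impI (impE hyp₁ (andE₂ hyp₀))))) (orI₂ (impI (impE hyp₁ (andE₁ hyp₀))))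
  | or φ ψ h₁ h₂ =>
    exact orE (h₁ h.1 _) (orI₁ (orI₁ hyp₀)) (orE (h₂ h.2 _) (orI₁ (orI₂ hyp₀))
      (orI₂ (impI (orE hyp₀ (impE hyp₃ hyp₀) (impE hyp₂ hyp₀)))))
  | imp φ ψ h₁ h₂ =>
    exact orE (h₂ h.2 _) (orI₁ (impI hyp₁)) (orE (h₁ h.1 _)
      (orI₂ (impI (impE hyp₂ (impE hyp₀ hyp₁)))) (orI₁ (impI (botE (impE hyp₁ hyp₀)))))
  | all | ex => exact h.elim

/-- A quantifier-free formula implies its translation, and its negation refutes it. The second part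
is needed for the first at implications, where the premise is decided. -/
theorem qf_trans (hT : HA ⊆ T) (h : φ.QF) (ρ : Formula) (Γ : List Formula) :
    Prf T (φ :: Γ) (φ.trans ρ) ∧ Prf T (φ.neg :: φ.trans ρ :: Γ) ρ := by
  induction φ generalizing Γ with
  | bot => exact ⟨botE hyp₀, hyp₁⟩
  | eq t s => exact ⟨dnegI hyp₀, impE hyp₁ (impI (botE (impE hyp₁ hyp₀)))⟩
  | and φ ψ h₁ h₂ =>
    refine ⟨andI (cut (andE₁ hyp₀) (h₁ h.1 _).1) (cut (andE₂ hyp₀) (h₂ h.2 _).1), ?_⟩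
    refine orE (qf_or_neg hT h.1 _) ?_ (cut (andE₁ hyp₂)
      ((h₁ h.1 (_ :: _)).2.weaken (List.Perm.swap _ _ _).subset))
    exact cut (andE₂ hyp₂) (cut (impI (impE hyp₃ (andI hyp₂ hyp₀))) (h₂ h.2 _).2)
  | or φ ψ h₁ h₂ =>
    refine ⟨dnegI (orE hyp₀ (orI₁ (h₁ h.1 _).1) (orI₂ (h₂ h.2 _).1)), ?_⟩
    refine impE hyp₁ (impI (orE hyp₀ ?_ ?_))
    · exact cut (impI (impE hyp₃ (orI₁ hyp₀))) (h₁ h.1 _).2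
    · exact cut (impI (impE hyp₃ (orI₂ hyp₀))) (h₂ h.2 _).2
  | imp φ ψ h₁ h₂ =>
    constructor
    · refine impI (orE (qf_or_neg hT h.1 _) ?_ (trans_exfalso (h₁ h.1 _).2))
      exact cut (impE hyp₂ hyp₀) (h₂ h.2 _).1
    · refine orE (qf_or_neg hT h.1 _) ?_
        (botE (impE hyp₁ (impI (botE (impE hyp₁ hyp₀)))))
      exact cut (impE hyp₂ (h₁ h.1 _).1) (cut (impI (impE hyp₃ (impI hyp₁))) (h₂ h.2 _).2)
  | all | ex => exact h.elim

/-- A prenex formula implies its translation, and its dual refutes its translation. -/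
theorem prenex_trans (hT : HA ⊆ T) (h : φ.Prenex) (ρ : Formula) (Γ : List Formula) :
    Prf T (φ :: Γ) (φ.trans ρ) ∧ Prf T (φ.dual :: φ.trans ρ :: Γ) ρ := by
  induction h generalizing ρ Γ with
  | qf h =>
    rw [h.dual_eq]
    exact qf_trans hT h ρ Γ
  | all _ ih =>
    constructor
    · exact allI (cut (allE₀ hyp₀) (ih _ _).1)
    · exact exE hyp₀ (cut (allE₀ hyp₂)
        ((ih _ (_ :: _)).2.weaken (List.Perm.swap _ _ _).subset))
  | ex _ ih =>
    constructor
    · exact dnegI (exE hyp₀ (exI₀ (ih _ _).1))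
    · exact impE hyp₁ (impI (exE hyp₀ (cut (allE₀ hyp₂) (ih _ _).2)))

theorem guardI (α φ : Formula) (Γ : List Formula) : Prf T (α :: φ :: Γ) (.guard α φ) := by
  induction φ generalizing α Γ with
  | all φ ih =>
    exact allI (cut (allE₀ hyp₁) ((ih α.lift (_ :: _)).weaken (List.Perm.swap _ _ _).subset))
  | ex φ ih =>
    exact exE hyp₁ (exI₀ ((ih α.lift (_ :: _)).weaken (List.Perm.swap _ _ _).subset))
  | _ => exact andI hyp₀ hyp₁

theorem guardE (α φ : Formula) (Γ : List Formula) :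
    Prf T (Formula.guard α φ :: Γ) (α.and φ) := by
  induction φ generalizing α Γ with
  | all φ ih =>
    have h : Prf T (Formula.guard α φ.all :: Γ) (.all (.and α.lift φ)) :=
      allI (cut (allE₀ hyp₀) (ih _ _))
    have h₁ := andE₁ (allE zeroTm h)
    have h₁' : Prf T (Formula.guard α φ.all :: Γ) (α.lift.inst zeroTm) := h₁
    rw [Formula.lift_inst] at h₁'
    exact andI h₁' (allI (cut (allE₀ hyp₀) (andE₂ (ih _ _))))
  | ex φ ih =>
    exact exE hyp₀ (cut (ih _ _) (andI (andE₁ hyp₀) (exI₀ (andE₂ hyp₀))))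
  | _ => exact hyp₀

end Prf

/-! ### Excluded middle with several free variables -/

/-- The substitution `0 ↦ a`, `1 ↦ b`, `n + 2 ↦ f n`. -/
def cons₂ (a b : Tm) (f : ℕ → Tm) : ℕ → Tm
  | 0 => a
  | 1 => b
  | n + 2 => f n

theorem Formula.subst_cons₂_subst (φ : Formula) (a b : Tm) (f σ : ℕ → Tm) :
    (φ.subst (cons₂ a b f)).subst σ =
      φ.subst (cons₂ (Term.subst a σ) (Term.subst b σ) (fun n => Term.subst (f n) σ)) := by
  rw [Formula.subst_subst]
  congr 1
  funext n
  rcases n with _ | _ | n <;> rfl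

namespace Formula

/-- The formula `∃ x y (z = ⟨x, y⟩ ∧ φ(x, y, …))`, which merges the variables `0` and `1` of `φ`
into one. The conjunct is placed in front of the matrix, so that no new quantifier alternation
arises. -/
def merge (φ : Formula) : Formula :=
  ex (ex (guard (eq (bvar 2) (pairTm (bvar 0) (bvar 1)))
    (φ.subst (cons₂ (bvar 0) (bvar 1) fun n => bvar (n + 3)))))

theorem merge_mem {k : ℕ} {φ : Formula} (h : φ ∈ SigmaClass (k + 1)) :
    φ.merge ∈ SigmaClass (k + 1) :=
  ex_mem_SigmaClass (ex_mem_SigmaClass ((guard_mem_prenexClass (k + 1)).1 _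
    ((subst_mem_prenexClass (k + 1)).1 _ h _) _ trivial))

theorem fv_merge_lt {φ : Formula} {n : ℕ} (h : ∀ m ∈ φ.fv, m < n + 2) :
    ∀ m ∈ φ.merge.fv, m < n + 1 := by
  intro m hm
  have hm' : m + 2 ∈ (guard (eq (bvar 2) (pairTm (bvar 0) (bvar 1)))
    (φ.subst (cons₂ (bvar 0) (bvar 1) fun n => bvar (n + 3)))).fv := hm
  rcases fv_guard _ _ hm' with (h' | h') | h'
  · simp [bvar, Term.varFinset] at h'
    omega
  · simp only [pairTm, app, Term.varFinset, Finset.coe_biUnion, Set.mem_iUnion] at h'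
    obtain ⟨i, -, h'⟩ := h'
    fin_cases i <;> simp [bvar, Term.varFinset] at h'
  · obtain ⟨l, hl, h'⟩ := exists_of_mem_fv_subst h'
    have := h l hl
    rcases l with _ | _ | l <;> simp [cons₂, bvar, Term.varFinset] at h'
    omega

/-- The instance of `merge φ` at a pair of variables. -/
theorem merge_subst (φ : Formula) :
    φ.merge.subst (fun n => match n with
      | 0 => pairTm (bvar 0) (bvar 1)
      | n + 1 => bvar (n + 2)) =
    ex (ex (guard (eq (pairTm (bvar 2) (bvar 3)) (pairTm (bvar 0) (bvar 1)))
      (φ.subst (cons₂ (bvar 0) (bvar 1) fun n => bvar (n + 4))))) := by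
  simp [merge, subst, guard_subst, subst_cons₂_subst]

end Formula

namespace Prf

variable {T : Set Formula} {Γ : List Formula} {φ : Formula}

theorem mergeI (hT : HA ⊆ T) (φ : Formula) (Γ : List Formula) : Prf T (φ :: Γ)
    (.ex (.ex (.guard (.eq (pairTm (bvar 2) (bvar 3)) (pairTm (bvar 0) (bvar 1)))
      (φ.subst (cons₂ (bvar 0) (bvar 1) fun n => bvar (n + 4)))))) := by
  refine exI (bvar 1) ?_
  simp only [Formula.inst, Formula.subst]
  refine exI (bvar 0) ?_
  have h : (fun n => bvar n) = cons₂ (bvar 0) (bvar 1) (fun n => bvar (n + 2)) := by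
    funext n
    rcases n with _ | _ | n <;> rfl
  have h' : φ.subst (cons₂ (bvar 0) (bvar 1) (fun n => bvar (n + 2))) = φ := by
    rw [← h]
    exact φ.subst_id
  simp [Formula.inst, Formula.guard_subst, Formula.subst_cons₂_subst, Formula.subst, h']
  exact cut (eqRefl hT _) (guardI _ _ _)

theorem mergeE (hT : HA ⊆ T) (φ : Formula) (Γ : List Formula) : Prf T
    (.ex (.ex (.guard (.eq (pairTm (bvar 2) (bvar 3)) (pairTm (bvar 0) (bvar 1)))
      (φ.subst (cons₂ (bvar 0) (bvar 1) fun n => bvar (n + 4))))) :: Γ) φ := by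
  refine exE hyp₀ (exE hyp₀ (cut (guardE _ _ _) ?_))
  -- `x' = x` and `y' = y` follow from the guard; replace `x'` and `y'` one after the other.
  generalize Formula.guard _ _ :: List.map Formula.lift _ = Δ
  have h₀ := pair_inj hT (andE₁ (hyp₀ (T := T) (Γ := Δ)
    (φ := .and (.eq (pairTm (bvar 2) (bvar 3)) (pairTm (bvar 0) (bvar 1)))
      (φ.subst (cons₂ (bvar 0) (bvar 1) fun n => bvar (n + 4))))))
  have h₁ := leibniz hT (φ.subst (cons₂ (bvar 0) (bvar 2) fun n => bvar (n + 5)))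
    (eqSymm hT (andE₁ h₀)) (by
      simp only [Formula.inst, Formula.subst_cons₂_subst, subst_bvar, instSubst_zero,
        instSubst_succ]
      exact andE₂ hyp₀)
  have h₂ := leibniz hT (φ.subst (cons₂ (bvar 3) (bvar 0) fun n => bvar (n + 5)))
    (eqSymm hT (andE₂ h₀)) (by
      simp only [Formula.inst, Formula.subst_cons₂_subst, subst_bvar, instSubst_zero,
        instSubst_succ] at h₁ ⊢
      exact h₁)
  have h : (fun n => bvar (n + 2)) = cons₂ (bvar 2) (bvar 3) (fun n => bvar (n + 4)) := by
    funext n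
    rcases n with _ | _ | n <;> rfl
  simp only [Formula.inst, Formula.subst_cons₂_subst, subst_bvar, instSubst_zero,
    instSubst_succ] at h₂
  simp only [Formula.lift, Formula.subst_subst, subst_bvar, add_assoc, Nat.reduceAdd]
  rw [h]
  exact h₂

/-- `Σ_k-LEM`, stated for formulas with one free variable, yields excluded middle for all
formulas in `Σ_k`. -/
theorem or_neg_of_mem_SigmaClass {k : ℕ} (hφ : φ ∈ SigmaClass k) :
    Prf (HA ∪ ClassLEM (SigmaClass k)) Γ (φ.or φ.neg) := by
  have hT : HA ⊆ HA ∪ ClassLEM (SigmaClass k) := Set.subset_union_left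
  cases k with
  | zero =>
    rw [SigmaClass] at hφ
    exact qf_or_neg hT hφ Γ
  | succ k =>
    refine of_nil ?_
    -- Induction on a bound for the free variables; `b = 0` allows just the variable `0`.
    obtain ⟨b, hb⟩ := φ.exists_fv_lt
    replace hb : ∀ m ∈ φ.fv, m < b + 1 := fun m hm => (hb m hm).trans (Nat.lt_succ_self b)
    induction b generalizing φ with
    | zero =>
      have hfv : φ.fv ⊆ {0} := fun m hm => Nat.lt_one_iff.1 (hb m hm)
      have h := allE (bvar 0) (ax (T := HA ∪ ClassLEM (SigmaClass (k + 1))) (Γ := [])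
        (Or.inr ⟨φ, hφ, hfv, rfl⟩))
      have h₀ : φ.subst (Formula.instSubst (bvar 0)) = φ := by
        conv_rhs => rw [← φ.subst_id]
        refine φ.subst_congr fun n hn => ?_
        rw [hfv hn]
        rfl
      simpa only [Formula.inst, Formula.subst, Formula.neg, h₀] using h
    | succ b ih =>
      have h := (ih (Formula.merge_mem hφ) (Formula.fv_merge_lt hb)).subst
        (substClosed_HA.union (substClosed_classLEM _))
        (fun n => match n with
          | 0 => pairTm (bvar 0) (bvar 1)
          | n + 1 => bvar (n + 2))
      simp only [Formula.subst, Formula.neg, Formula.merge_subst, List.map_nil] at h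
      exact orE h (orI₁ (mergeE hT φ _)) (orI₂ (impI (impE hyp₁ (mergeI hT φ _))))

/-! ### Conservation -/

/-- Over `Σ_k-LEM`, a formula in `Σ_j` or `Π_j` with `j ≤ k` holds or its dual does. -/
theorem or_dual {k j : ℕ} (hj : j ≤ k) :
    (∀ φ ∈ SigmaClass j, ∀ Γ, Prf (HA ∪ ClassLEM (SigmaClass k)) Γ (φ.or φ.dual)) ∧
      (∀ φ ∈ PiClass j, ∀ Γ, Prf (HA ∪ ClassLEM (SigmaClass k)) Γ (φ.or φ.dual)) := by
  induction j with
  | zero =>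
    simp only [SigmaClass, PiClass]
    exact ⟨fun φ h Γ => h.dual_eq ▸ qf_or_neg Set.subset_union_left h Γ,
      fun φ h Γ => h.dual_eq ▸ qf_or_neg Set.subset_union_left h Γ⟩
  | succ j ih =>
    replace ih := ih (Nat.le_of_succ_le hj)
    refine ⟨SigmaClass_succ_induction ih.2 fun φ hφ ih Γ => ?_,
      PiClass_succ_induction ih.1 fun φ hφ ih Γ => ?_⟩
    · refine orE (or_neg_of_mem_SigmaClass (SigmaClass_mono hj (ex_mem_SigmaClass hφ)))
        (orI₁ hyp₀) (orI₂ (allI (orE (ih _) (botE ?_) hyp₀)))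
      exact impE (φ := φ.ex.lift) hyp₁ (exI₀ hyp₀)
    · refine orE (or_neg_of_mem_SigmaClass (SigmaClass_mono hj (ex_mem_SigmaClass
        ((dual_mem_prenexClass (j + 1)).2 φ hφ)))) (orI₂ hyp₀)
        (orI₁ (allI (orE (ih _) hyp₀ (botE ?_))))
      exact impE (φ := φ.dual.ex.lift) hyp₁ (exI₀ hyp₀)

/-- A formula `φ` in `Σ_{k+1}` may be recovered from its translation: if `φ` implies `ρ`, so does
its translation relative to `ρ`. -/
theorem of_trans_SigmaClass_succ {k : ℕ} : ∀ φ ∈ SigmaClass (k + 1), ∀ ρ Γ,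
    Prf (HA ∪ ClassLEM (SigmaClass k)) (Formula.trans φ ρ :: φ.imp ρ :: Γ) ρ := by
  refine SigmaClass_succ_induction (fun φ hφ ρ Γ => ?_) (fun φ _ ih ρ Γ => ?_)
  · exact orE ((or_dual le_rfl).2 φ hφ _) (impE hyp₂ hyp₀)
      (prenex_trans Set.subset_union_left ((prenex_of_mem_prenexClass k).2 φ hφ) ρ _).2
  · refine impE hyp₀ (impI (exE hyp₀ (cut (φ := φ.imp ρ.lift) (impI ?_)
      ((ih ρ.lift (_ :: _)).weaken (List.Perm.swap _ _ _).subset))))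
    have h : ∀ {Δ : List Formula} {α β γ δ}, Prf (HA ∪ ClassLEM (SigmaClass k))
        (α :: β :: γ :: δ :: Formula.lift (φ.ex.imp ρ) :: Δ) (.imp φ.ex.lift ρ.lift) :=
      hyp (by simp [Formula.lift, Formula.subst])
    exact impE h (exI₀ hyp₀)

end Prf

end Arith

open Arith Prf in
theorem mainTheorem3 (k : ℕ) (φ ψ : Arith.Formula)
    (hφ : φ ∈ Arith.PiClass (k + 2)) (hψ : Arith.IsPrenex ψ)
    (h : Arith.Provable Arith.PA (ψ.imp φ)) :
    Arith.Provable (Arith.HA ∪ Arith.ClassLEM (Arith.SigmaClass k)) (ψ.imp φ) := by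
  have hT : HA ⊆ HA ∪ ClassLEM (SigmaClass k) := Set.subset_union_left
  refine PiClass_succ_induction (P := fun φ => ∀ ψ : Formula, ψ.Prenex → Prf PA [] (ψ.imp φ) →
    Prf (HA ∪ ClassLEM (SigmaClass k)) [] (ψ.imp φ)) ?_ ?_ φ hφ ψ hψ.prenex h
  · intro φ hφ ψ hψ h
    have h₁ : Prf (HA ∪ ClassLEM (SigmaClass k)) [] ((ψ.trans φ).imp (φ.trans φ)) := h.trans hT φ
    -- The translation relative to `φ` itself: the hypothesis `φ → ρ` becomes trivial.
    exact impI (cut (impI hyp₀) (cut (impE_nil h₁ (cut hyp₁ (prenex_trans hT hψ φ _).1))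
      (of_trans_SigmaClass_succ φ hφ φ _)))
  · intro φ _ ih ψ hψ h
    have h₁ : Prf PA [] (ψ.lift.imp φ.all.lift) := h.lift substClosed_PA
    exact impI (allI (impE_nil (ih ψ.lift (hψ.subst _) (impI (allE₀ (impE_nil h₁ hyp₀)))) hyp₀))
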